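/- **Theorem 1.** Let $m\ge 1$. The inner cuckoo table $C$ is the following dictionary. It consists of two tables $R_0,R_1$ with $\lceil m^{2/3}\rceil$ cells each, every cell holding at most one item (a key-value pair), two hash functions $f_0,f_1$ from the keys to the cells, and a list $L$ made up of two deques, InnerQueue and InnerStash, whose entries are pairs $(x,b)$ of an item $x$ and the index $b\in\{0,1\}$ of the table it is to be put in next. Every stored item with key $k$ is in cell $R_0[f_0(k)]$, in cell $R_1[f_1(k)]$, or in $L$. Initially everything is empty. A *move* on an entry $(x,b)$, where $x$ has key $k$, puts $x$ into $R_b[f_b(k)]$; if that cell was vacant the insertion process ends, otherwise the former occupant $y$ is evicted and the process goes on with $(y,1-b)$. The process *creates a second cycle* as soon as the items it has moved or evicted, viewed as edges joining their cells in $R_0$ and in $R_1$, form a graph with more edges than vertices; the item evicted at that moment, together with the index of its other table, is then put at the back of InnerStash and the process ends. * Insert $(k,v)$: spend up to 16 moves on $((k,v),0)$; if they end neither at a vacant cell nor in a second cycle, the current entry is put at the back of InnerQueue. * Delete $k$: remove the item with key $k$ from its cell or from $L$. Lookup $k$: inspect the two cells of $k$ and $L$. * At the end of every $\lceil m^{1/6}\rceil$-th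 operation (of any kind), the entry at the front of InnerQueue is removed and up to 16 moves are spent on it (with the same rules as for an insert), and then the entry at the front of InnerStash is removed and a single move is spent on it, the current entry being put at the back of InnerStash if the cell was not vacant. Steps are counted at unit cost: evaluations of a hash function, reads and writes of a cell, deque operations at the front or rear, counter accesses, and the comparisons used to detect second cycles. There are absolute constants $c>0$ and $A$ such that the following holds. Let $f_0,f_1$ be fully random (all values $f_b(k)$ independent and uniform), let $p$ be a polynomial, $n$ a natural number, and let $\pi'$ be a sequence of $p(n)$ insert, delete and lookup operations, fixed independently of the hash functions, in which only keys that are not currently present are inserted and which is $m^{1/3}$-bounded, i.e. at every point in time the data structure contains at most $m^{1/3}$ elements. Let $0\le s\le m^{1/6}$ be real. Then with probability at least $$1-\frac{p(n)}{m^{c\sqrt s}}$$ over the choice of $f_0,f_1$, when $\pi'$ is executed on $C$, every insert completes within $A$ steps (including the work on InnerQueue and InnerStash done at the end of that operation), and $L$ contains at most $s$ items after every initial segment of $\pi'$. -/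

import Mathlib

open MeasureTheory ProbabilityTheory

namespace InnerCuckoo

/-- A key-value pair. -/
structure Item (K V : Type*) where
  key : K
  val : V

/-- The operations. -/
inductive Op (K V : Type*) where
  | insert (k : K) (v : V)
  | delete (k : K)
  | lookup (k : K)

/-- A result together with the number of elementary steps spent on computing it. An elementary step
is one evaluation of a hash function, one read or write of a table cell, one operation at the
front or the rear of a deque, one access to a counter, or one comparison of two keys or cells. -/
structure Timed (α : Type*) where
  val : α
  steps : ℕ

/-- The cells of the two tables: `(false, c)` is cell `c` of `R₀`, `(true, c)` is cell `c` of `R₁`. -/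
abbrev Cell (M : ℕ) := Bool × Fin M

/-- The contents of the two tables: every cell stores at most one item. -/
abbrev Tables (K V : Type*) (M : ℕ) := Cell M → Option (Item K V)

/-- The pair of hash functions: `f false` is `f₀` and `f true` is `f₁`. -/
abbrev Hash (K : Type*) (M : ℕ) := Bool → K → Fin M

/-- An entry of one of the deques of `L`: an item, and the table it is to be inserted in next. -/
abbrev Entry (K V : Type*) := Item K V × Bool

/-- The inner cuckoo table: the tables `R₀` and `R₁`, the two deques `queue` (InnerQueue) and `stash`
(InnerStash) that make up `L` (the head of a list is the front of the deque), and a counter of the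
operations since the deques were last served. -/
structure State (K V : Type*) (M : ℕ) where
  tables : Tables K V M
  queue : List (Entry K V)
  stash : List (Entry K V)
  clock : ℕ

/-- The number of items in `L`. -/
def State.sizeL {K V : Type*} {M : ℕ} (σ : State K V M) : ℕ := σ.queue.length + σ.stash.length

/-- The empty data structure. -/
def State.empty (K V : Type*) (M : ℕ) : State K V M where
  tables := fun _ => none
  queue := []
  stash := []
  clock := 0

section Algorithm

variable {K V : Type*} [DecidableEq K] {M : ℕ}

/-- The marks of the cycle detection during one insertion process: the items that have been moved
and the cells that have been met (the edges and the vertices of the part of the cuckoo graph that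
the process has explored), and the number of cycles that have been closed so far. -/
structure Marks (K : Type*) (M : ℕ) where
  keys : List K
  cells : List (Cell M)
  cycles : ℕ

/-- The marks at the start of an insertion process for the key `k`. -/
def Marks.start (f : Hash K M) (k : K) : Marks K M where
  keys := [k]
  cells := [(false, f false k), (true, f true k)]
  cycles := 0

/-- The item with key `k` has just been evicted and has to go to table `b`: an item that is met for
the first time marks its new cell, and closes a cycle if this cell is marked already. -/
def Marks.visit (f : Hash K M) (μ : Marks K M) (k : K) (b : Bool) : Timed (Marks K M) where
  val :=
    if k ∈ μ.keys then μ
    else if (b, f b k) ∈ μ.cells then ⟨k :: μ.keys, μ.cells, μ.cycles + 1⟩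
    else ⟨k :: μ.keys, (b, f b k) :: μ.cells, μ.cycles⟩
  steps := 2 + μ.keys.length + μ.cells.length

/-- How a sequence of moves may end: a vacant cell was found, or the last move created a second
cycle, or all the moves were used up; in the last two cases with the item that is now without a
cell, and the table it has to go to next. -/
inductive Outcome (K V : Type*) where
  | placed
  | secondCycle (e : Entry K V)
  | unfinished (e : Entry K V)

/-- Spend up to the given number of moves on the insertion of the entry `(x, b)`. A move puts `x` into
its cell of table `b`; if the cell was vacant, the process ends, otherwise the former occupant `y` is
evicted, and the process goes on with `y` and the other table, unless a second cycle was created. -/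
def insertMoves (f : Hash K M) :
    ℕ → Tables K V M → Entry K V → Marks K M → Timed (Tables K V M × Outcome K V)
  | 0, R, e, _ => ⟨(R, .unfinished e), 0⟩
  | n + 1, R, (x, b), μ =>
    let c : Cell M := (b, f b x.key)
    let R' := Function.update R c (some x)
    match R c with
    | none => ⟨(R', .placed), 3⟩
    | some y =>
      let μ' := μ.visit f y.key (!b)
      if 2 ≤ μ'.val.cycles then ⟨(R', .secondCycle (y, !b)), 4 + μ'.steps⟩
      else
        let r := insertMoves f n R' (y, !b) μ'.val
        ⟨r.val, 4 + μ'.steps + r.steps⟩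

/-- Spend 16 moves on the entry `e`. If a second cycle is created, the current item goes to the back
of InnerStash; if the moves do not suffice, the current item goes to the back of InnerQueue. -/
def attempt (f : Hash K M) (σ : State K V M) (e : Entry K V) : Timed (State K V M) :=
  let r := insertMoves f 16 σ.tables e (Marks.start f e.1.key)
  { val :=
      match r.val.2 with
      | .placed => { σ with tables := r.val.1 }
      | .secondCycle e' => { σ with tables := r.val.1, stash := σ.stash ++ [e'] }
      | .unfinished e' => { σ with tables := r.val.1, queue := σ.queue ++ [e'] }
    steps := 4 + r.steps + 1 }

/-- Spend 16 moves on the entry at the front of InnerQueue. -/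
def serveQueue (f : Hash K M) (σ : State K V M) : Timed (State K V M) :=
  match σ.queue with
  | [] => ⟨σ, 1⟩
  | e :: rest =>
    let r := attempt f { σ with queue := rest } e
    ⟨r.val, 1 + r.steps⟩

/-- Spend a single move on the entry at the front of InnerStash; if no vacant cell was found, the
current item goes to the back of InnerStash. -/
def serveStash (f : Hash K M) (σ : State K V M) : Timed (State K V M) :=
  match σ.stash with
  | [] => ⟨σ, 1⟩
  | e :: rest =>
    let r := insertMoves f 1 σ.tables e (Marks.start f e.1.key)
    { val :=
        match r.val.2 with
        | .placed => { σ with tables := r.val.1, stash := rest }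
        | .secondCycle e' => { σ with tables := r.val.1, stash := rest ++ [e'] }
        | .unfinished e' => { σ with tables := r.val.1, stash := rest ++ [e'] }
      steps := 1 + (4 + r.steps + 1) }

/-- The end of every operation: in every `q`-th operation, serve the two deques. -/
def tick (f : Hash K M) (q : ℕ) (σ : State K V M) : Timed (State K V M) :=
  if q ≤ σ.clock + 1 then
    let r₁ := serveQueue f { σ with clock := 0 }
    let r₂ := serveStash f r₁.val
    ⟨r₂.val, 2 + r₁.steps + r₂.steps⟩
  else ⟨{ σ with clock := σ.clock + 1 }, 2⟩

/-- Whether the cell `c` holds an item with key `k`. -/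
def holds (R : Tables K V M) (c : Cell M) (k : K) : Bool := (R c).any fun x => x.key = k

/-- Insert an item: spend 16 moves on it immediately, starting with table `R₀`. -/
def insertItem (f : Hash K M) (σ : State K V M) (k : K) (v : V) : Timed (State K V M) :=
  attempt f σ (⟨k, v⟩, false)

/-- Remove the item with key `k` from its cell, or else from `L`. -/
def deleteKey (f : Hash K M) (σ : State K V M) (k : K) : Timed (State K V M) :=
  if holds σ.tables (false, f false k) k then
    ⟨{ σ with tables := Function.update σ.tables (false, f false k) none }, 4⟩
  else if holds σ.tables (true, f true k) k then
    ⟨{ σ with tables := Function.update σ.tables (true, f true k) none }, 7⟩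
  else
    ⟨{ σ with
        queue := σ.queue.filter fun e => e.1.key ≠ k
        stash := σ.stash.filter fun e => e.1.key ≠ k }, 7 + 2 * σ.sizeL⟩

/-- Look the key `k` up in its two cells and in `L`. -/
def lookupKey (f : Hash K M) (σ : State K V M) (k : K) : Timed (Option V) :=
  if holds σ.tables (false, f false k) k then
    ⟨(σ.tables (false, f false k)).map Item.val, 3⟩
  else if holds σ.tables (true, f true k) k then
    ⟨(σ.tables (true, f true k)).map Item.val, 6⟩
  else
    ⟨((σ.queue ++ σ.stash).find? fun e => e.1.key = k).map fun e => e.1.val, 6 + 2 * σ.sizeL⟩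

/-- Execute one operation, serving the deques in every `q`-th operation. -/
def exec (f : Hash K M) (q : ℕ) (σ : State K V M) (o : Op K V) : Timed (State K V M) :=
  let r : Timed (State K V M) :=
    match o with
    | .insert k v => insertItem f σ k v
    | .delete k => deleteKey f σ k
    | .lookup k => ⟨σ, (lookupKey f σ k).steps⟩
  let t := tick f q r.val
  ⟨t.val, r.steps + t.steps⟩

/-- The state after a sequence of operations on the initially empty data structure. -/
def run (f : Hash K M) (q : ℕ) (ops : List (Op K V)) : State K V M :=
  ops.foldl (fun σ o => (exec f q σ o).val) (State.empty K V M)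

/-- The set of (the keys of) the elements that the data structure contains after a sequence of
operations. -/
def contents (ops : List (Op K V)) : Finset K :=
  ops.foldl (fun S o =>
    match o with
    | .insert k _ => insert k S
    | .delete k => S.erase k
    | .lookup _ => S) ∅

/-- At any point in time the data structure contains at most `N` elements. -/
def IsBounded (N : ℝ) (ops : List (Op K V)) : Prop :=
  ∀ pre, pre <+: ops → ((contents pre).card : ℝ) ≤ N

/-- Every element that is inserted is new: its key is not present at that time. -/
def InsertsNew (ops : List (Op K V)) : Prop :=
  ∀ (pre : List (Op K V)) (k : K) (v : V), pre ++ [Op.insert k v] <+: ops → k ∉ contents pre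

/-- While the sequence is executed, every insertion completes within `A` steps. -/
def InsertsWithin (f : Hash K M) (q A : ℕ) (ops : List (Op K V)) : Prop :=
  ∀ (pre : List (Op K V)) (k : K) (v : V), pre ++ [Op.insert k v] <+: ops →
    (exec f q (run f q pre) (Op.insert k v)).steps ≤ A

/-- While the sequence is executed, `L` has at most `s` items at all points in time. -/
def SmallL (f : Hash K M) (q : ℕ) (s : ℝ) (ops : List (Op K V)) : Prop :=
  ∀ pre, pre <+: ops → ((run f q pre).sizeL : ℝ) ≤ s

end Algorithm

/-- The number of cells of each of the tables, `m ^ (2/3)` rounded up. -/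
noncomputable def tableSize (m : ℕ) : ℕ := ⌈(m : ℝ) ^ (2 / 3 : ℝ)⌉₊

/-- The number of operations between two services of the deques, `m ^ (1/6)` rounded up. -/
noncomputable def period (m : ℕ) : ℕ := ⌈(m : ℝ) ^ (1 / 6 : ℝ)⌉₊

/-- A fully random pair of hash functions: all the hash values are independent and uniform. -/
structure IsFullyRandom {Ω K : Type*} [MeasurableSpace Ω] {M : ℕ} (P : Measure Ω)
    (F : Ω → Hash K M) : Prop where
  measurable : ∀ b k, Measurable fun ω => F ω b k
  indep : iIndepFun (fun (i : Bool × K) ω => F ω i.1 i.2) P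
  uniform : ∀ b k c, P.real {ω | F ω b k = c} = 1 / M

end InnerCuckoo

/-!
Only 16 moves are made at a time and the marks of a process grow by at most two per move, so every insert
takes boundedly many steps for every choice of the hash functions. The probability is needed for the
size of `L` only.

Call a key *crowded* in a set `S` of keys if, in the cuckoo graph of `S` (keys are edges, cells are
vertices), its component has at least three edges or a cycle; locally this means that it lies in a
*cherry*: a key together with two collisions of other keys with it. An insertion attempt that fails
has evicted at least two items, and the last one is crowded (`insertMoves_start_crowded`).
A single move of InnerStash evicts an item `y` by an item `x` that had itself been displaced from the
other table, so `x` is the centre of a cherry containing `y` (`Inv.serveStash`), provided that the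
displacement of `x` is taken into account too. As the deques are first-in-first-out, an entry waits for at
most `O(s) * period` operations while `L` has at most `s` entries. Therefore, at the first time at
which `L` has more than `s` entries, all of them are crowded in the set of keys present at some point
during the last `O(m ^ (1/3))` operations (`Inv.sizeL_le`); this set does not depend on the hash
functions and has `O(m ^ (1/3))` keys (`card_window_le`).

If more than `s` keys are crowded, then the cuckoo graph can be explored in `⌊s / 3⌋ + 1` steps, each of which
attaches a key to an explored one or adds a new cherry (`chain_of_card_crowded`). With `n = O(m ^ (1/3))`
keys, `d = O(m ^ (1/6))` explored ones and `M ≥ m ^ (2/3)` cells, a step multiplies the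
probability by at most `2 n d / M + 4 n ^ 3 / M ^ 2 = O(m ^ (-1/6))` (`IsFullyRandom.chain_le`). A union bound
over the operations finishes the proof for large `m`. For bounded `m` the constant `c` makes the claimed
bound trivial if there are two operations or more, and a single operation leaves `L` empty.
-/

namespace InnerCuckoo

section Moves

variable {K V : Type*} {M : ℕ}

/-! ### Cherries in the cuckoo graph -/

/-- The leaves `u` and `v` form a cherry centred at the key `x`: the edges of the keys `u.2` and `v.2`
meet the edge of `x` in the tables `u.1` and `v.1`. The two keys may coincide if the tables differ,
so that a double edge of the cuckoo graph is a cherry as well. -/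
def IsCherry (f : Hash K M) (x : K) (u v : Bool × K) : Prop :=
  u.2 ≠ x ∧ v.2 ≠ x ∧ u ≠ v ∧ f u.1 u.2 = f u.1 x ∧ f v.1 v.2 = f v.1 x

/-- The key `k` belongs to a cherry all of whose keys are in `S`. Equivalently, the component of the edge
`k` in the cuckoo graph of `S` has at least three edges or a cycle. -/
def Crowded (f : Hash K M) (S : Finset K) (k : K) : Prop :=
  ∃ x ∈ S, ∃ u v : Bool × K, u.2 ∈ S ∧ v.2 ∈ S ∧ IsCherry f x u v ∧ (k = x ∨ k = u.2 ∨ k = v.2)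

theorem Crowded.mono {f : Hash K M} {S T : Finset K} (h : S ⊆ T) {k : K} :
    Crowded f S k → Crowded f T k := by
  rintro ⟨x, hx, u, v, hu, hv, hc⟩
  exact ⟨x, h hx, u, v, h hu, h hv, hc⟩

theorem Crowded.mem {f : Hash K M} {S : Finset K} {k : K} : Crowded f S k → k ∈ S := by
  rintro ⟨x, hx, u, v, hu, hv, -, rfl | rfl | rfl⟩ <;> assumption

/-- Crowdedness is inherited by every key that shares a cell with a crowded key. -/
theorem Crowded.neighbor {f : Hash K M} {S : Finset K} {x y : K} {b : Bool} (hx : Crowded f S x)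
    (hy : y ∈ S) (hne : y ≠ x) (h : f b y = f b x) : Crowded f S y := by
  have key : ∀ c ∈ S, ∀ w w' : Bool × K, w.2 ∈ S → w'.2 ∈ S → IsCherry f c w w' → x = w.2 →
      Crowded f S y := by
    rintro c hc ⟨d, z⟩ w' hw hw' hch rfl
    obtain ⟨h1, h2, h3, h4, h5⟩ := hch
    by_cases hyc : (b, y) = (d, c)
    · obtain ⟨rfl, rfl⟩ := Prod.mk.inj hyc
      exact ⟨y, hc, _, w', hw, hw', ⟨h1, h2, h3, h4, h5⟩, Or.inl rfl⟩
    · exact ⟨x, hw, (b, y), (d, c), hy, hc, ⟨hne, h1.symm, hyc, h, h4.symm⟩, Or.inr (Or.inl rfl)⟩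
  obtain ⟨c, hc, u, v, hu, hv, hch, hk⟩ := hx
  have hch' : IsCherry f c v u := ⟨hch.2.1, hch.1, hch.2.2.1.symm, hch.2.2.2.2, hch.2.2.2.1⟩
  rcases hk with rfl | hk | hk
  · by_cases hyu : (b, y) = u
    · subst hyu
      exact ⟨x, hc, _, v, hu, hv, hch, Or.inr (Or.inl rfl)⟩
    · exact ⟨x, hc, (b, y), u, hy, hu, ⟨hne, hch.1, hyu, h, hch.2.2.2.1⟩, Or.inr (Or.inl rfl)⟩
  · exact key c hc u v hu hv hch hk
  · exact key c hc v u hv hu hch' hk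

/-- Two keys that meet the key `x` in different tables form a cherry with it. -/
theorem crowded_of_both {f : Hash K M} {S : Finset K} {x y z : K} {b : Bool} (hx : x ∈ S)
    (hy : y ∈ S) (hz : z ∈ S) (hyx : y ≠ x) (hzx : z ≠ x) (h1 : f b y = f b x)
    (h2 : f (!b) z = f (!b) x) : Crowded f S y :=
  ⟨x, hx, (b, y), (!b, z), hy, hz, ⟨hyx, hzx, by simp, h1, h2⟩, Or.inr (Or.inl rfl)⟩

/-- The item of the entry `e` is crowded in `S`, or it shares its cell in the table other than `e.2`, from
which it has been evicted, with another key of `S`. -/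
def Displaced (f : Hash K M) (S : Finset K) (e : Entry K V) : Prop :=
  Crowded f S e.1.key ∨ ∃ x ∈ S, x ≠ e.1.key ∧ f (!e.2) x = f (!e.2) e.1.key

theorem Displaced.mono {f : Hash K M} {S T : Finset K} (h : S ⊆ T) {e : Entry K V} :
    Displaced f S e → Displaced f T e := by
  rintro (hc | ⟨x, hx, hx'⟩)
  · exact Or.inl (hc.mono h)
  · exact Or.inr ⟨x, h hx, hx'⟩

/-! ### The placement invariant -/

/-- The tables `R` hold pairwise different keys in their proper cells, the keys `ks` that wait outside of
the tables are pairwise different and not in the tables, and all these keys are in `C`. -/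
structure Config (f : Hash K M) (R : Tables K V M) (ks : List K) (C : Finset K) : Prop where
  placed : ∀ c x, R c = some x → f c.1 x.key = c.2
  inj : ∀ c c' x x', R c = some x → R c' = some x' → x.key = x'.key → c = c'
  nodup : ks.Nodup
  disjoint : ∀ c x, R c = some x → x.key ∉ ks
  table_mem : ∀ c x, R c = some x → x.key ∈ C
  mem : ∀ k ∈ ks, k ∈ C

theorem Config.subperm {f : Hash K M} {R : Tables K V M} {ks ks' : List K} {C : Finset K}
    (h : Config f R ks C) (hs : ks'.Subperm ks) : Config f R ks' C where
  placed := h.placed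
  inj := h.inj
  nodup := by
    obtain ⟨l, hl, hl'⟩ := hs
    exact hl.nodup_iff.1 (h.nodup.sublist hl')
  disjoint c x hx hk := h.disjoint c x hx (hs.subset hk)
  table_mem := h.table_mem
  mem k hk := h.mem k (hs.subset hk)

/-- An evicted item shares the cell with a different key. -/
theorem Config.evicted {f : Hash K M} {R : Tables K V M} {ks : List K} {C : Finset K}
    {x y : Item K V} {b : Bool} (h : Config f R (x.key :: ks) C)
    (hc : R (b, f b x.key) = some y) :
    x.key ∈ C ∧ y.key ∈ C ∧ y.key ≠ x.key ∧ f b y.key = f b x.key :=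
  ⟨h.mem _ (by simp), h.table_mem _ _ hc, fun hk => h.disjoint _ _ hc (by simp [hk]),
    h.placed _ _ hc⟩

theorem Config.put_vacant {f : Hash K M} {R : Tables K V M} {ks : List K} {C : Finset K}
    {x : Item K V} {b : Bool} (h : Config f R (x.key :: ks) C) (hc : R (b, f b x.key) = none) :
    Config f (Function.update R (b, f b x.key) (some x)) ks C := by
  set c : Cell M := (b, f b x.key) with hcdef
  have hR : ∀ c' y, Function.update R c (some x) c' = some y →
      (c' = c ∧ y = x) ∨ (c' ≠ c ∧ R c' = some y) := by
    intro c' y hy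
    by_cases hcc : c' = c
    · subst hcc; simp at hy; exact Or.inl ⟨rfl, hy.symm⟩
    · exact Or.inr ⟨hcc, by simpa [hcc] using hy⟩
  have hnd := List.nodup_cons.1 h.nodup
  have hne : ∀ c' y, R c' = some y → y.key ≠ x.key := fun c' y hy hk =>
    h.disjoint c' y hy (by simp [hk])
  refine ⟨?_, ?_, hnd.2, ?_, ?_, fun k hk => h.mem k (by simp [hk])⟩
  · intro c' y hy
    rcases hR _ _ hy with ⟨rfl, rfl⟩ | ⟨-, hy⟩
    · rfl
    · exact h.placed _ _ hy
  · intro c₁ c₂ y₁ y₂ h₁ h₂ hk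
    rcases hR _ _ h₁ with ⟨e₁, e₁'⟩ | ⟨-, h₁⟩ <;> rcases hR _ _ h₂ with ⟨e₂, e₂'⟩ | ⟨-, h₂⟩
    · rw [e₁, e₂]
    · exact absurd (by rw [← hk, e₁']) (hne _ _ h₂)
    · exact absurd (by rw [hk, e₂']) (hne _ _ h₁)
    · exact h.inj _ _ _ _ h₁ h₂ hk
  · intro c' y hy
    rcases hR _ _ hy with ⟨rfl, rfl⟩ | ⟨-, hy⟩
    · exact hnd.1
    · exact fun hk => h.disjoint _ _ hy (by simp [hk])
  · intro c' y hy
    rcases hR _ _ hy with ⟨rfl, rfl⟩ | ⟨-, hy⟩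
    · exact h.mem _ (by simp)
    · exact h.table_mem _ _ hy

variable [DecidableEq K]

theorem Config.update_none {f : Hash K M} {R : Tables K V M} {ks : List K} {C : Finset K}
    (h : Config f R ks C) {c : Cell M} {k : K} {x : Item K V} (hc : R c = some x) (hk : x.key = k) :
    Config f (Function.update R c none) ks (C.erase k) := by
  have hR : ∀ c' y, Function.update R c none c' = some y → c' ≠ c ∧ R c' = some y := by
    intro c' y hy
    by_cases hcc : c' = c
    · subst hcc; simp at hy
    · exact ⟨hcc, by simpa [hcc] using hy⟩
  refine ⟨fun c' y hy => h.placed c' y (hR _ _ hy).2,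
    fun c₁ c₂ y₁ y₂ h₁ h₂ => h.inj _ _ _ _ (hR _ _ h₁).2 (hR _ _ h₂).2, h.nodup,
    fun c' y hy => h.disjoint c' y (hR _ _ hy).2, fun c' y hy => ?_, fun k' hk' => ?_⟩
  · refine Finset.mem_erase.2 ⟨fun hyk => ?_, h.table_mem c' y (hR _ _ hy).2⟩
    exact (hR _ _ hy).1 (h.inj _ _ _ _ (hR _ _ hy).2 hc (hyk.trans hk.symm))
  · refine Finset.mem_erase.2 ⟨fun hkk => ?_, h.mem k' hk'⟩
    exact h.disjoint c x hc (by rw [hk, ← hkk]; exact hk')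

theorem Config.put_occupied {f : Hash K M} {R : Tables K V M} {ks : List K} {C : Finset K}
    {x y : Item K V} {b : Bool} (h : Config f R (x.key :: ks) C)
    (hc : R (b, f b x.key) = some y) :
    Config f (Function.update R (b, f b x.key) (some x)) (y.key :: ks) C := by
  set c : Cell M := (b, f b x.key) with hcdef
  -- Evicting `y` first reduces the claim to putting `x` into a vacant cell.
  have h₀ : Config f (Function.update R c none) (x.key :: y.key :: ks) C := by
    have h₁ := h.update_none hc rfl
    have hy := h.disjoint c y hc
    refine ⟨h₁.placed, h₁.inj, ?_, ?_, fun c' z hz => Finset.mem_of_mem_erase (h₁.table_mem c' z hz), ?_⟩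
    · have := h.nodup
      simp only [List.mem_cons, not_or, List.nodup_cons] at this hy ⊢
      exact ⟨⟨fun h => hy.1 h.symm, this.1⟩, hy.2, this.2⟩
    · intro c' z hz hzk
      have h₂ := h₁.disjoint c' z hz
      have h₃ := Finset.ne_of_mem_erase (h₁.table_mem c' z hz)
      simp only [List.mem_cons, not_or] at hzk h₂
      tauto
    · intro k hk
      have := h.mem k
      simp only [List.mem_cons] at hk this
      rcases hk with rfl | rfl | hk
      · exact this (Or.inl rfl)
      · exact h.table_mem _ _ hc
      · exact this (Or.inr hk)
  have := h₀.put_vacant (b := b) (by simp [hcdef])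
  simpa [← hcdef] using this

/-! ### Insertion processes -/

/-- The entry that an insertion process leaves without a cell, if there is one. -/
def Outcome.entries : Outcome K V → List (Entry K V)
  | .placed => []
  | .secondCycle e => [e]
  | .unfinished e => [e]

theorem insertMoves_config {f : Hash K M} {C : Finset K} {ks : List K} (n : ℕ) :
    ∀ (R : Tables K V M) (e : Entry K V) (μ : Marks K M), Config f R (e.1.key :: ks) C →
      Config f (insertMoves f n R e μ).val.1
        ((insertMoves f n R e μ).val.2.entries.map (fun e => e.1.key) ++ ks) C := by
  induction n with
  | zero => intro R e μ h; simpa [insertMoves, Outcome.entries] using h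
  | succ n ih =>
    rintro R ⟨x, b⟩ μ h
    simp only [insertMoves]
    split
    · rename_i hc
      simpa [Outcome.entries] using h.put_vacant hc
    · rename_i y hc
      have h' := h.put_occupied hc
      split
      · simpa [Outcome.entries] using h'
      · exact ih _ (y, !b) _ h'

theorem insertMoves_crowded {f : Hash K M} {C : Finset K} {ks : List K} (n : ℕ) :
    ∀ (R : Tables K V M) (e : Entry K V) (μ : Marks K M), Config f R (e.1.key :: ks) C →
      Crowded f C e.1.key →
      ∀ e' ∈ (insertMoves f n R e μ).val.2.entries, Crowded f C e'.1.key := by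
  induction n with
  | zero => intro R e μ _ h; simpa [insertMoves, Outcome.entries] using h
  | succ n ih =>
    rintro R ⟨x, b⟩ μ h hx
    simp only [insertMoves]
    split
    · simp [Outcome.entries]
    · rename_i y hc
      obtain ⟨-, hy, hyx, hf⟩ := h.evicted hc
      have hyc := hx.neighbor hy hyx hf
      split
      · simpa [Outcome.entries] using hyc
      · exact ih _ (y, !b) _ (h.put_occupied hc) hyc

theorem Marks.visit_cycles_le (f : Hash K M) (μ : Marks K M) (k : K) (b : Bool) :
    (μ.visit f k b).val.cycles ≤ μ.cycles + 1 := by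
  simp only [Marks.visit]
  split_ifs <;> simp

/-- An insertion process with at least two moves that fails to find a vacant cell leaves a crowded key:
the first eviction closes at most one cycle, hence there is a second one, and the first three keys form
a cherry. -/
theorem insertMoves_start_crowded {f : Hash K M} {C : Finset K} {ks : List K} (n : ℕ)
    (R : Tables K V M) (e : Entry K V) (h : Config f R (e.1.key :: ks) C) :
    ∀ e' ∈ (insertMoves f (n + 2) R e (Marks.start f e.1.key)).val.2.entries,
      Crowded f C e'.1.key := by
  obtain ⟨x, b⟩ := e
  rw [insertMoves]
  dsimp only
  split
  · simp [Outcome.entries]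
  rename_i y hc
  obtain ⟨hx, hy, hyx, hf⟩ := h.evicted hc
  have h' := h.put_occupied hc
  rw [if_neg (by
    have := Marks.visit_cycles_le f (Marks.start f x.key) y.key (!b)
    simp only [Marks.start] at this ⊢
    omega)]
  generalize (Marks.visit f (Marks.start f x.key) y.key (!b)).val = μ
  dsimp only
  rw [insertMoves]
  dsimp only
  split
  · simp [Outcome.entries]
  rename_i z hc'
  obtain ⟨-, hz, hzy, hf'⟩ := h'.evicted hc'
  have hzc : Crowded f C z.key :=
    crowded_of_both (b := !b) hy hz hx hzy hyx.symm hf' (by simpa using hf.symm)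
  split
  · simpa [Outcome.entries] using hzc
  · exact insertMoves_crowded n _ (z, !!b) _ (h'.put_occupied hc') hzc

theorem insertMoves_one_entries (f : Hash K M) (R : Tables K V M) (e : Entry K V) (μ : Marks K M) :
    ∀ e' ∈ (insertMoves f 1 R e μ).val.2.entries,
      R (e.2, f e.2 e.1.key) = some e'.1 ∧ e'.2 = !e.2 := by
  obtain ⟨x, b⟩ := e
  simp only [insertMoves]
  split
  · simp [Outcome.entries]
  · rename_i y hc
    split <;> simp [Outcome.entries, hc]

theorem insertMoves_steps_le (f : Hash K M) (n : ℕ) :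
    ∀ (R : Tables K V M) (e : Entry K V) (μ : Marks K M),
      (insertMoves f n R e μ).steps ≤ n * (6 + μ.keys.length + μ.cells.length + 2 * n) := by
  induction n with
  | zero => intro R e μ; simp [insertMoves]
  | succ n ih =>
    rintro R ⟨x, b⟩ μ
    simp only [insertMoves]
    split
    · simp only; nlinarith
    · rename_i y _
      have hv : ((μ.visit f y.key (!b)).val.keys.length + (μ.visit f y.key (!b)).val.cells.length ≤
          μ.keys.length + μ.cells.length + 2) := by
        simp only [Marks.visit]; split_ifs <;> simp <;> omega
      have hs : (μ.visit f y.key (!b)).steps = 2 + μ.keys.length + μ.cells.length := rfl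
      split
      · simp only [hs]; nlinarith
      · simp only [hs]
        have := ih (Function.update R (b, f b x.key) (some x)) (y, !b) (μ.visit f y.key (!b)).val
        nlinarith

theorem attempt_steps_le (f : Hash K M) (σ : State K V M) (e : Entry K V) :
    (attempt f σ e).steps ≤ 661 := by
  have := insertMoves_steps_le f 16 σ.tables e (Marks.start f e.1.key)
  simp only [Marks.start, List.length_cons, List.length_nil] at this
  simp only [attempt, Marks.start]
  omega

theorem serveQueue_steps_le (f : Hash K M) (σ : State K V M) : (serveQueue f σ).steps ≤ 662 := by
  unfold serveQueue
  split
  · simp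
  · rename_i e rest _
    have := attempt_steps_le f { σ with queue := rest } e
    dsimp only
    omega

theorem serveStash_steps_le (f : Hash K M) (σ : State K V M) : (serveStash f σ).steps ≤ 17 := by
  unfold serveStash
  split
  · simp
  · rename_i e rest _
    have := insertMoves_steps_le f 1 σ.tables e (Marks.start f e.1.key)
    simp only [Marks.start, List.length_cons, List.length_nil] at this
    simp only [Marks.start]
    omega

theorem exec_insert_steps_le (f : Hash K M) (q : ℕ) (σ : State K V M) (k : K) (v : V) :
    (exec f q σ (Op.insert k v)).steps ≤ 1342 := by
  have h₁ := attempt_steps_le f σ (⟨k, v⟩, false)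
  have h₂ : ∀ σ : State K V M, (tick f q σ).steps ≤ 681 := by
    intro σ
    unfold tick
    split
    · have h₂ := serveQueue_steps_le f { σ with clock := 0 }
      have h₃ := serveStash_steps_le f (serveQueue f { σ with clock := 0 }).val
      dsimp only
      omega
    · simp
  have h₃ := h₂ (attempt f σ (⟨k, v⟩, false)).val
  simp only [exec, insertItem]
  omega

end Moves

/-! ### Ages of the entries of a deque -/

section Aged

variable {α : Type*}

/-- The entry at position `p` of the deque has the property `Q` for the age `(d - p) * q + c`. If the deque
has been served every `q` operations, last `c` operations ago, and never had more than `d` entries, then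
this bounds the number of operations since the entry was put at the back. -/
def Aged (Q : ℕ → α → Prop) (q c : ℕ) : ℕ → List α → Prop
  | _, [] => True
  | d, e :: l => Q (d * q + c) e ∧ Aged Q q c (d - 1) l

variable {Q Q' : ℕ → α → Prop} {q c : ℕ}

theorem Aged.mono_depth (hQ : ∀ a a' e, a ≤ a' → Q a e → Q a' e) {l : List α} :
    ∀ {d d' : ℕ}, d ≤ d' → Aged Q q c d l → Aged Q q c d' l := by
  induction l with
  | nil => intros; trivial
  | cons e l ih =>
    intro d d' hd h
    exact ⟨hQ _ _ _ (by gcongr) h.1, ih (Nat.sub_le_sub_right hd 1) h.2⟩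

theorem Aged.filter (hQ : ∀ a a' e, a ≤ a' → Q a e → Q a' e) (r : α → Bool) {l : List α} :
    ∀ {d : ℕ}, Aged Q q c d l → Aged Q q c d (l.filter r) := by
  induction l with
  | nil => intros; trivial
  | cons e l ih =>
    intro d h
    rw [List.filter_cons]
    split
    · exact ⟨h.1, ih h.2⟩
    · exact (ih h.2).mono_depth hQ (Nat.sub_le d 1)

theorem Aged.push (hQ : ∀ a a' e, a ≤ a' → Q a e → Q a' e) {e : α} (he : Q 0 e) {l : List α} :
    ∀ {d : ℕ}, Aged Q q c d l → Aged Q q c d (l ++ [e]) := by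
  induction l with
  | nil => intro d _; exact ⟨hQ _ _ _ (Nat.zero_le _) he, trivial⟩
  | cons e l ih => intro d h; exact ⟨h.1, ih h.2⟩

theorem Aged.step (hQ : ∀ a e, Q a e → Q' (a + 1) e) {l : List α} :
    ∀ {d : ℕ}, Aged Q q c d l → Aged Q' q (c + 1) d l := by
  induction l with
  | nil => intros; trivial
  | cons e l ih => intro d h; exact ⟨hQ _ _ h.1, ih h.2⟩

/-- When the front entry is served, the other entries move forward by one position. -/
theorem Aged.pop (hQ : ∀ a a' e, a ≤ a' → Q a e → Q a' e) (hc : c ≤ q) {l : List α} :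
    ∀ {d : ℕ}, l.length < d → Aged Q q c (d - 1) l → Aged Q q 0 d l := by
  induction l with
  | nil => intros; trivial
  | cons e l ih =>
    intro d hd h
    obtain ⟨d, rfl⟩ : ∃ d', d = d' + 1 := ⟨d - 1, by omega⟩
    refine ⟨hQ _ _ _ ?_ h.1, ih (by simpa using hd) h.2⟩
    rw [Nat.add_sub_cancel]
    linarith [add_one_mul d q]

theorem Aged.forall_mem (hQ : ∀ a a' e, a ≤ a' → Q a e → Q a' e) {l : List α} :
    ∀ {d : ℕ}, Aged Q q c d l → ∀ e ∈ l, Q (d * q + c) e := by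
  induction l with
  | nil => simp
  | cons e l ih =>
    intro d h e' he'
    rcases List.mem_cons.1 he' with rfl | he'
    · exact h.1
    · exact hQ _ _ _ (by gcongr; omega) (ih h.2 e' he')

end Aged

section Deques

variable {K V : Type*} [DecidableEq K] {M : ℕ}

/-! ### The keys present in a window of time -/

/-- The keys that are present at some time among the last `a` operations before time `t`, including the
times `t` and `t - a` themselves. -/
def window (ops : List (Op K V)) (t a : ℕ) : Finset K :=
  (Finset.range (a + 1)).biUnion fun i => contents (ops.take (t - i))

theorem mem_window {ops : List (Op K V)} {t a : ℕ} {k : K} :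
    k ∈ window ops t a ↔ ∃ i ≤ a, k ∈ contents (ops.take (t - i)) := by
  simp [window]

theorem contents_subset_window (ops : List (Op K V)) (t a : ℕ) :
    contents (ops.take t) ⊆ window ops t a := fun _ hk => mem_window.2 ⟨0, a.zero_le, hk⟩

theorem window_mono (ops : List (Op K V)) (t : ℕ) {a a' : ℕ} (h : a ≤ a') :
    window ops t a ⊆ window ops t a' := fun _ hk => by
  obtain ⟨i, hi, hk⟩ := mem_window.1 hk
  exact mem_window.2 ⟨i, hi.trans h, hk⟩

theorem window_succ_subset (ops : List (Op K V)) (t a : ℕ) :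
    window ops t a ⊆ window ops (t + 1) (a + 1) := fun _ hk => by
  obtain ⟨i, hi, hk⟩ := mem_window.1 hk
  exact mem_window.2 ⟨i + 1, by omega, by simpa using hk⟩

theorem contents_concat (pre : List (Op K V)) (o : Op K V) :
    contents (pre ++ [o]) = match o with
      | .insert k _ => insert k (contents pre)
      | .delete k => (contents pre).erase k
      | .lookup _ => contents pre := by
  cases o <;> simp [contents]

theorem card_contents_sdiff_le (pre : List (Op K V)) (o : Op K V) :
    (contents (pre ++ [o]) \ contents pre).card ≤ 1 := by
  rw [contents_concat]
  cases o with
  | insert k v =>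
    calc (insert k (contents pre) \ contents pre).card ≤ ({k} : Finset K).card := by
          apply Finset.card_le_card
          intro x; simp only [Finset.mem_sdiff, Finset.mem_insert, Finset.mem_singleton]; tauto
      _ = 1 := by simp
  | delete k => simp [Finset.sdiff_eq_empty_iff_subset.2 (Finset.erase_subset _ _)]
  | lookup k => simp

/-- One operation brings at most one new key into the window. -/
theorem card_window_succ_le (ops : List (Op K V)) (t a : ℕ) :
    (window ops (t + 1) (a + 1)).card ≤ (window ops t a).card + 1 := by
  have h : window ops (t + 1) (a + 1) ⊆
      window ops t a ∪ (contents (ops.take (t + 1)) \ contents (ops.take t)) := by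
    intro k hk
    obtain ⟨i, hi, hk⟩ := mem_window.1 hk
    simp only [Finset.mem_union, Finset.mem_sdiff]
    rcases i with _ | i
    · by_cases h : k ∈ contents (ops.take t)
      · exact Or.inl (contents_subset_window _ _ _ h)
      · exact Or.inr ⟨hk, h⟩
    · exact Or.inl (mem_window.2 ⟨i, by omega, by simpa using hk⟩)
  refine (Finset.card_le_card h).trans ((Finset.card_union_le _ _).trans ?_)
  gcongr
  by_cases ht : t < ops.length
  · rw [List.take_succ_eq_append_getElem ht]
    exact card_contents_sdiff_le _ _
  · rw [List.take_of_length_le (by omega), List.take_of_length_le (by omega)]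
    simp

theorem card_window_le {ops : List (Op K V)} {N : ℝ} (h : IsBounded N ops) (a : ℕ) :
    ∀ t, ((window ops t a).card : ℝ) ≤ N + a := by
  have h₀ : ∀ t, ((contents (ops.take t)).card : ℝ) ≤ N := fun t => h _ (List.take_prefix _ _)
  induction a with
  | zero => intro t; simpa [window] using h₀ t
  | succ a ih =>
    intro t
    rcases t with _ | t
    · have : window ops 0 (a + 1) = ∅ := by
        ext k; simp [mem_window, contents]
      have hN := (Nat.cast_nonneg _).trans (h₀ 0)
      rw [this]
      push_cast
      simp only [Finset.card_empty, Nat.cast_zero]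
      positivity
    · have := card_window_succ_le ops t a
      have h' := ih t
      push_cast
      calc ((window ops (t + 1) (a + 1)).card : ℝ) ≤ ((window ops t a).card + 1 : ℕ) := by
            exact_mod_cast this
        _ ≤ _ := by push_cast; linarith

theorem card_window_le_length {ops : List (Op K V)} (t a : ℕ) :
    (window ops t a).card ≤ t := by
  induction t generalizing a with
  | zero =>
    have : window ops 0 a = ∅ := by
      ext k; simp [mem_window, contents]
    simp [this]
  | succ t ih =>
    have := card_window_succ_le ops t a
    have := Finset.card_le_card (window_mono ops (t + 1) (Nat.le_add_right a 1))
    have := ih a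
    omega

/-! ### The invariant of the deques -/

/-- The keys that wait in the deques. -/
def State.keysL (σ : State K V M) : List K :=
  σ.queue.map (fun e => e.1.key) ++ σ.stash.map (fun e => e.1.key)

/-- The entry `e` is displaced in the last `a` operations before time `t`, and crowded if `W` more
operations are taken into account. -/
def Stuck (f : Hash K M) (ops : List (Op K V)) (W t a : ℕ) (e : Entry K V) : Prop :=
  Crowded f (window ops t (W + a)) e.1.key ∧ Displaced f (window ops t a) e

theorem Stuck.mono {f : Hash K M} {ops : List (Op K V)} {W t : ℕ} (a a' : ℕ) (e : Entry K V)
    (h : a ≤ a') : Stuck f ops W t a e → Stuck f ops W t a' e := fun hs =>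
  ⟨hs.1.mono (window_mono _ _ (by omega)), hs.2.mono (window_mono _ _ h)⟩

theorem Stuck.step {f : Hash K M} {ops : List (Op K V)} {W t : ℕ} (a : ℕ) (e : Entry K V) :
    Stuck f ops W t a e → Stuck f ops W (t + 1) (a + 1) e := fun hs =>
  ⟨hs.1.mono (window_succ_subset _ _ _), hs.2.mono (window_succ_subset _ _ _)⟩

theorem Crowded.stuck {f : Hash K M} {ops : List (Op K V)} {W t : ℕ} {e : Entry K V}
    (h : Crowded f (contents (ops.take t)) e.1.key) : Stuck f ops W t 0 e :=
  ⟨h.mono (contents_subset_window _ _ _), Or.inl (h.mono (contents_subset_window _ _ _))⟩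

/-- The invariant of the state `σ` at time `t`, if the deques were served last `c` operations ago: every
entry of the deques is stuck for its age, where `D` bounds the lengths of the deques and
`(D + 1) * q` the time that an entry waits for service. -/
structure Inv (f : Hash K M) (q D : ℕ) (ops : List (Op K V)) (t c : ℕ) (σ : State K V M) : Prop where
  config : Config f σ.tables σ.keysL (contents (ops.take t))
  queue : Aged (Stuck f ops ((D + 1) * q) t) q c D σ.queue
  stash : Aged (Stuck f ops ((D + 1) * q) t) q c D σ.stash

/-- An insertion attempt either leaves the deques alone or puts one crowded key into one of them. -/
theorem attempt_spec {f : Hash K M} {C : Finset K} (σ : State K V M) (e : Entry K V)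
    (h : Config f σ.tables (e.1.key :: σ.keysL) C) :
    Config f (attempt f σ e).val.tables (attempt f σ e).val.keysL C ∧
      (attempt f σ e).val.clock = σ.clock ∧
      (((attempt f σ e).val.queue = σ.queue ∧ (attempt f σ e).val.stash = σ.stash) ∨
        ∃ e', Crowded f C e'.1.key ∧
          (((attempt f σ e).val.queue = σ.queue ++ [e'] ∧ (attempt f σ e).val.stash = σ.stash) ∨
            ((attempt f σ e).val.queue = σ.queue ∧
              (attempt f σ e).val.stash = σ.stash ++ [e']))) := by
  have h₁ := insertMoves_config 16 σ.tables e (Marks.start f e.1.key) h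
  have h₂ := insertMoves_start_crowded 14 σ.tables e h
  simp only [attempt]
  generalize insertMoves f 16 σ.tables e (Marks.start f e.1.key) = r at h₁ h₂
  obtain ⟨⟨R, o⟩, n⟩ := r
  cases o with
  | placed => exact ⟨by simpa [Outcome.entries, State.keysL] using h₁, rfl, Or.inl ⟨rfl, rfl⟩⟩
  | secondCycle e' =>
    refine ⟨h₁.subperm (List.Perm.subperm ?_), rfl,
      Or.inr ⟨e', h₂ e' (by simp [Outcome.entries]), Or.inr ⟨rfl, rfl⟩⟩⟩
    simp only [Outcome.entries, State.keysL]
    grind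
  | unfinished e' =>
    refine ⟨h₁.subperm (List.Perm.subperm ?_), rfl,
      Or.inr ⟨e', h₂ e' (by simp [Outcome.entries]), Or.inl ⟨rfl, rfl⟩⟩⟩
    simp only [Outcome.entries, State.keysL]
    grind

theorem Inv.attempt {f : Hash K M} {q D : ℕ} {ops : List (Op K V)} {t c c' : ℕ} {σ : State K V M}
    {e : Entry K V} (hc : Config f σ.tables (e.1.key :: σ.keysL) (contents (ops.take t)))
    (hq : Aged (Stuck f ops ((D + 1) * q) t) q c D σ.queue)
    (hs : Aged (Stuck f ops ((D + 1) * q) t) q c' D σ.stash) :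
    Config f (attempt f σ e).val.tables (attempt f σ e).val.keysL (contents (ops.take t)) ∧
    Aged (Stuck f ops ((D + 1) * q) t) q c D (attempt f σ e).val.queue ∧
    Aged (Stuck f ops ((D + 1) * q) t) q c' D (attempt f σ e).val.stash ∧
    (attempt f σ e).val.clock = σ.clock ∧
    (attempt f σ e).val.queue.length ≤ σ.queue.length + 1 ∧
    (attempt f σ e).val.stash.length ≤ σ.stash.length + 1 := by
  obtain ⟨h₁, h₂, h₃⟩ := attempt_spec σ e hc
  refine ⟨h₁, ?_⟩
  rcases h₃ with ⟨h₃, h₄⟩ | ⟨e', he', ⟨h₃, h₄⟩ | ⟨h₃, h₄⟩⟩ <;> rw [h₃, h₄]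
  · exact ⟨hq, hs, h₂, by simp, by simp⟩
  · exact ⟨hq.push Stuck.mono he'.stuck, hs, h₂, by simp, by simp⟩
  · exact ⟨hq, hs.push Stuck.mono he'.stuck, h₂, by simp, by simp⟩

/-- A key that is evicted by the front entry of InnerStash is crowded, as the front entry was itself
displaced, in the other table. -/
theorem Inv.serveStash {f : Hash K M} {q D : ℕ} {ops : List (Op K V)} {t c : ℕ} {σ : State K V M}
    (hc : Config f σ.tables σ.keysL (contents (ops.take t)))
    (hs : Aged (Stuck f ops ((D + 1) * q) t) q c D σ.stash) (hcq : c ≤ q)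
    (hlen : σ.stash.length ≤ D) :
    Config f (serveStash f σ).val.tables (serveStash f σ).val.keysL (contents (ops.take t)) ∧
    (serveStash f σ).val.queue = σ.queue ∧ (serveStash f σ).val.clock = σ.clock ∧
    Aged (Stuck f ops ((D + 1) * q) t) q 0 D (serveStash f σ).val.stash := by
  unfold InnerCuckoo.serveStash
  split
  · rename_i h
    exact ⟨hc, rfl, rfl, by simp only [h]; trivial⟩
  rename_i e rest h
  rw [h] at hs hlen
  have hc' : Config f σ.tables
      (e.1.key :: (σ.queue.map (fun e => e.1.key) ++ rest.map (fun e => e.1.key)))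
      (contents (ops.take t)) := by
    refine hc.subperm (List.Perm.subperm ?_)
    simp only [State.keysL, h]
    grind
  have h₁ := insertMoves_config 1 σ.tables e (Marks.start f e.1.key) hc'
  have h₂ := insertMoves_one_entries f σ.tables e (Marks.start f e.1.key)
  have hrest : Aged (Stuck f ops ((D + 1) * q) t) q 0 D rest :=
    Aged.pop Stuck.mono hcq (by simpa using hlen) hs.2
  have hstuck : ∀ e', σ.tables (e.2, f e.2 e.1.key) = some e'.1 → e'.2 = !e.2 →
      Stuck f ops ((D + 1) * q) t 0 e' := by
    intro e' he' hb
    obtain ⟨hx, hy, hyx, hf⟩ := hc'.evicted he'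
    refine ⟨?_, Or.inr ⟨e.1.key, contents_subset_window _ _ _ hx, hyx.symm, by simp [hb, hf]⟩⟩
    have hd : Displaced f (window ops t ((D + 1) * q)) e :=
      hs.1.2.mono (window_mono _ _ (by linarith [add_one_mul D q]))
    rcases hd with hd | ⟨z, hz, hzx, hfz⟩
    · exact hd.neighbor (contents_subset_window _ _ _ hy) hyx hf
    · exact crowded_of_both (contents_subset_window _ _ _ hx) (contents_subset_window _ _ _ hy)
        hz hyx hzx hf hfz
  generalize insertMoves f 1 σ.tables e (Marks.start f e.1.key) = r at h₁ h₂
  obtain ⟨⟨R, o⟩, n⟩ := r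
  have hperm : ∀ e' : Entry K V, o.entries = [e'] →
      Config f R (State.keysL ⟨R, σ.queue, rest ++ [e'], σ.clock⟩) (contents (ops.take t)) := by
    intro e' ho
    refine h₁.subperm (List.Perm.subperm ?_)
    simp only [ho, State.keysL]
    grind
  cases o with
  | placed =>
    exact ⟨by simpa [Outcome.entries, State.keysL] using h₁, rfl, rfl, hrest⟩
  | secondCycle e' =>
    have := h₂ e' (by simp [Outcome.entries])
    exact ⟨hperm e' rfl, rfl, rfl, hrest.push Stuck.mono (hstuck e' this.1 this.2)⟩
  | unfinished e' =>
    have := h₂ e' (by simp [Outcome.entries])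
    exact ⟨hperm e' rfl, rfl, rfl, hrest.push Stuck.mono (hstuck e' this.1 this.2)⟩

theorem Inv.tick {f : Hash K M} {q D : ℕ} {ops : List (Op K V)} {t : ℕ} {σ : State K V M}
    (h : Inv f q D ops t (σ.clock + 1) σ) (hcq : σ.clock < q)
    (hq : σ.queue.length ≤ D) (hs : σ.stash.length + 1 ≤ D) :
    Inv f q D ops t (tick f q σ).val.clock (tick f q σ).val ∧ (tick f q σ).val.clock < q := by
  unfold InnerCuckoo.tick
  split
  swap
  · rename_i hlt
    exact ⟨⟨h.config, h.queue, h.stash⟩, by simpa using hlt⟩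
  have hsq : Config f (serveQueue f { σ with clock := 0 }).val.tables
      (serveQueue f { σ with clock := 0 }).val.keysL (contents (ops.take t)) ∧
    Aged (Stuck f ops ((D + 1) * q) t) q 0 D (serveQueue f { σ with clock := 0 }).val.queue ∧
    Aged (Stuck f ops ((D + 1) * q) t) q (σ.clock + 1) D
      (serveQueue f { σ with clock := 0 }).val.stash ∧
    (serveQueue f { σ with clock := 0 }).val.clock = 0 ∧
    (serveQueue f { σ with clock := 0 }).val.stash.length ≤ σ.stash.length + 1 := by
    unfold serveQueue
    split
    · rename_i hnil
      dsimp only at hnil ⊢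
      exact ⟨h.config, by rw [hnil]; trivial, h.stash, rfl, by simp⟩
    · rename_i e rest hcons
      dsimp only at hcons ⊢
      have haged := h.queue
      rw [hcons] at haged hq
      have hrest := Aged.pop Stuck.mono hcq (by simpa using hq) haged.2
      have hcfg : Config f σ.tables
          (e.1.key :: State.keysL ⟨σ.tables, rest, σ.stash, 0⟩) (contents (ops.take t)) := by
        refine h.config.subperm (List.Perm.subperm ?_)
        simp [State.keysL, hcons]
      have := Inv.attempt (σ := ⟨σ.tables, rest, σ.stash, 0⟩) hcfg hrest h.stash
      exact ⟨this.1, this.2.1, this.2.2.1, this.2.2.2.1, this.2.2.2.2.2⟩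
  obtain ⟨h₁, h₂, h₃, h₄, h₅⟩ := hsq
  obtain ⟨g₁, g₂, g₃, g₄⟩ := Inv.serveStash h₁ h₃ hcq (h₅.trans hs)
  dsimp only
  rw [g₃, h₄]
  exact ⟨⟨g₁, by rw [g₂]; exact h₂, g₄⟩, by omega⟩

theorem deleteKey_clock (f : Hash K M) (σ : State K V M) (k : K) :
    (deleteKey f σ k).val.clock = σ.clock := by
  unfold deleteKey; split_ifs <;> rfl

theorem deleteKey_config {f : Hash K M} {C : Finset K} {σ : State K V M}
    (h : Config f σ.tables σ.keysL C) (k : K) :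
    Config f (deleteKey f σ k).val.tables (deleteKey f σ k).val.keysL (C.erase k) := by
  have hholds : ∀ c, holds σ.tables c k = true → ∃ x, σ.tables c = some x ∧ x.key = k := by
    intro c hc
    simpa [holds, Option.any_eq_true] using hc
  unfold deleteKey
  split_ifs with h₁ h₂
  · obtain ⟨x, hx, hk⟩ := hholds _ h₁
    exact h.update_none hx hk
  · obtain ⟨x, hx, hk⟩ := hholds _ h₂
    exact h.update_none hx hk
  · have hsub : (State.keysL ⟨σ.tables, σ.queue.filter fun e => e.1.key ≠ k,
        σ.stash.filter fun e => e.1.key ≠ k, σ.clock⟩).Sublist σ.keysL :=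
      (List.filter_sublist.map _).append (List.filter_sublist.map _)
    have h' := h.subperm hsub.subperm
    refine ⟨h'.placed, h'.inj, h'.nodup, h'.disjoint, fun c x hx => ?_, fun k' hk' => ?_⟩
    · refine Finset.mem_erase.2 ⟨fun hxk => ?_, h.table_mem c x hx⟩
      have hp := h.placed c x hx
      obtain ⟨b, i⟩ := c
      simp only at hp
      subst hp
      rw [← hxk] at h₁ h₂
      replace hx : σ.tables (b, f b x.key) = some x := hx
      cases b
      · exact h₁ (by simp [holds, hx])
      · exact h₂ (by simp [holds, hx])
    · refine Finset.mem_erase.2 ⟨fun hkk => ?_, h'.mem k' hk'⟩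
      subst hkk
      simp only [State.keysL, List.mem_append, List.mem_map, List.mem_filter] at hk'
      grind

theorem deleteKey_aged {f : Hash K M} {Q : ℕ → Entry K V → Prop} {q c D : ℕ} {σ : State K V M}
    (hQ : ∀ a a' e, a ≤ a' → Q a e → Q a' e) (k : K)
    (h₁ : Aged Q q c D σ.queue) (h₂ : Aged Q q c D σ.stash) :
    Aged Q q c D (deleteKey f σ k).val.queue ∧ Aged Q q c D (deleteKey f σ k).val.stash ∧
    (deleteKey f σ k).val.queue.length ≤ σ.queue.length ∧
    (deleteKey f σ k).val.stash.length ≤ σ.stash.length := by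
  unfold deleteKey
  split_ifs
  · exact ⟨h₁, h₂, le_rfl, le_rfl⟩
  · exact ⟨h₁, h₂, le_rfl, le_rfl⟩
  · exact ⟨h₁.filter hQ _, h₂.filter hQ _, List.length_filter_le _ _, List.length_filter_le _ _⟩

/-- One operation preserves the invariant. The slack of two entries is needed as InnerStash may grow by an
entry in the operation itself and by another one in the service of InnerQueue, before its own front
entry is removed. -/
theorem Inv.exec {f : Hash K M} {q D : ℕ} {ops : List (Op K V)} (hnew : InsertsNew ops) {t : ℕ}
    (ht : t < ops.length) {σ : State K V M} (h : Inv f q D ops t σ.clock σ) (hcq : σ.clock < q)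
    (hsize : σ.sizeL + 2 ≤ D) :
    Inv f q D ops (t + 1) (exec f q σ ops[t]).val.clock (exec f q σ ops[t]).val ∧
      (exec f q σ ops[t]).val.clock < q := by
  have hq := h.queue.step Stuck.step
  have hs := h.stash.step Stuck.step
  have hcon : contents (ops.take (t + 1)) = contents (ops.take t ++ [ops[t]]) := by
    rw [List.take_succ_eq_append_getElem ht]
  have hpre : ops.take t ++ [ops[t]] <+: ops := by
    rw [← List.take_succ_eq_append_getElem ht]; exact List.take_prefix _ _
  simp only [State.sizeL] at hsize
  rw [contents_concat] at hcon
  unfold InnerCuckoo.exec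
  cases ho : ops[t] with
  | insert k v =>
    simp only [ho] at hcon hpre ⊢
    have hk := hnew _ k v hpre
    have hcfg : Config f σ.tables (k :: σ.keysL) (contents (ops.take (t + 1))) := by
      rw [hcon]
      have h' := h.config
      refine ⟨h'.placed, h'.inj, List.nodup_cons.2 ⟨fun hm => hk (h'.mem k hm), h'.nodup⟩, ?_,
        fun c x hx => Finset.mem_insert_of_mem (h'.table_mem c x hx), ?_⟩
      · intro c x hx hm
        rcases List.mem_cons.1 hm with hm | hm
        · exact hk (hm ▸ h'.table_mem c x hx)
        · exact h'.disjoint c x hx hm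
      · intro k' hm
        rcases List.mem_cons.1 hm with hm | hm
        · simp [hm]
        · exact Finset.mem_insert_of_mem (h'.mem k' hm)
    obtain ⟨g₁, g₂, g₃, g₄, g₅, g₆⟩ := Inv.attempt (e := (⟨k, v⟩, false)) hcfg hq hs
    refine Inv.tick ⟨g₁, ?_, ?_⟩ ?_ ?_ ?_ <;> simp only [insertItem, g₄] <;>
      first | assumption | omega
  | delete k =>
    simp only [ho] at hcon ⊢
    have hcfg := deleteKey_config h.config k
    rw [← hcon] at hcfg
    obtain ⟨g₁, g₂, g₃, g₄⟩ := deleteKey_aged (f := f) Stuck.mono k hq hs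
    have g₅ := deleteKey_clock f σ k
    refine Inv.tick ⟨hcfg, ?_, ?_⟩ ?_ ?_ ?_
    · rw [g₅]; exact g₁
    · rw [g₅]; exact g₂
    · rw [g₅]; exact hcq
    · omega
    · omega
  | lookup k =>
    simp only [ho] at hcon ⊢
    refine Inv.tick ⟨?_, hq, hs⟩ hcq ?_ ?_
    · rw [hcon]; exact h.config
    · omega
    · omega

theorem Inv.run {f : Hash K M} {q D : ℕ} (hq0 : 0 < q) {ops : List (Op K V)}
    (hnew : InsertsNew ops) (t : ℕ) (ht : t ≤ ops.length)
    (hsize : ∀ t' < t, (run f q (ops.take t')).sizeL + 2 ≤ D) :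
    Inv f q D ops t (run f q (ops.take t)).clock (run f q (ops.take t)) ∧
      (run f q (ops.take t)).clock < q := by
  induction t with
  | zero =>
    refine ⟨⟨⟨?_, ?_, ?_, ?_, ?_, ?_⟩, ?_, ?_⟩, ?_⟩ <;>
      simp [InnerCuckoo.run, State.empty, State.keysL, Aged, hq0]
  | succ t ih =>
    obtain ⟨h₁, h₂⟩ := ih (by omega) fun t' ht' => hsize t' (by omega)
    have := h₁.exec hnew (by omega) h₂ (hsize t (by omega))
    rw [List.take_succ_eq_append_getElem (by omega : t < ops.length)]
    simpa only [InnerCuckoo.run, List.foldl_append, List.foldl_cons, List.foldl_nil] using this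

open Classical in
/-- All the keys in the deques are crowded. -/
theorem Inv.sizeL_le {f : Hash K M} {q D : ℕ} {ops : List (Op K V)} {t : ℕ} {σ : State K V M}
    (h : Inv f q D ops t σ.clock σ) (hcq : σ.clock < q) :
    σ.sizeL ≤ ((window ops t (2 * ((D + 1) * q))).filter
      (Crowded f (window ops t (2 * ((D + 1) * q))))).card := by
  have hcard : σ.sizeL = σ.keysL.toFinset.card := by
    rw [List.toFinset_card_of_nodup h.config.nodup]
    simp [State.sizeL, State.keysL]
  rw [hcard]
  apply Finset.card_le_card
  have hw : ∀ e : Entry K V, Stuck f ops ((D + 1) * q) t (D * q + σ.clock) e →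
      e.1.key ∈ (window ops t (2 * ((D + 1) * q))).filter
        (Crowded f (window ops t (2 * ((D + 1) * q)))) := by
    intro e he
    have := he.1.mono (window_mono ops t
      (a' := 2 * ((D + 1) * q)) (by linarith [add_one_mul D q]))
    exact Finset.mem_filter.2 ⟨this.mem, this⟩
  intro k hk
  simp only [State.keysL, List.toFinset_append, Finset.mem_union, List.mem_toFinset,
    List.mem_map] at hk
  rcases hk with ⟨e, he, rfl⟩ | ⟨e, he, rfl⟩
  · exact hw e (h.queue.forall_mem Stuck.mono e he)
  · exact hw e (h.stash.forall_mem Stuck.mono e he)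

end Deques

/-! ### Chains of collisions -/

section Chain

variable {K : Type*} [DecidableEq K] {M : ℕ}

/-- Starting from the set `l` of explored keys, the cuckoo graph of `S` can be explored in `i` further
steps, each of which either adds a new key that shares a cell with an explored one, or adds a cherry
of new keys. -/
def Chain (f : Hash K M) (S : Finset K) : ℕ → Finset K → Prop
  | 0, _ => True
  | i + 1, l =>
    (∃ x ∈ S, ∃ y ∈ l, ∃ b, (x ∉ l ∧ f b x = f b y) ∧ Chain f S i (insert x l)) ∨
    ∃ x ∈ S, ∃ y ∈ S, ∃ z ∈ S, ∃ b c,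
      ((x ∉ l ∧ y ∉ l ∧ z ∉ l) ∧ IsCherry f x (b, y) (c, z)) ∧
        Chain f S i (insert x (insert y (insert z l)))

open Classical in
/-- As every step adds at most three keys, a crowded key stays unexplored as long as three times the
number of steps is less than the number of crowded keys. Its cherry is either disjoint from
the explored keys, or has a new key next to an explored one. -/
theorem chain_of_card_crowded {f : Hash K M} {S : Finset K} (i : ℕ) :
    ∀ l : Finset K, l.card + 3 * i ≤ (S.filter (Crowded f S)).card + 2 → Chain f S i l := by
  induction i with
  | zero => intros; trivial
  | succ i ih =>
    intro l hl
    obtain ⟨k, hk, hkl⟩ := Finset.exists_mem_notMem_of_card_lt_card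
      (s := l) (t := S.filter (Crowded f S)) (by omega)
    obtain ⟨x, hx, ⟨b, y⟩, ⟨c, z⟩, hy, hz, hch, hk⟩ := (Finset.mem_filter.1 hk).2
    have hext : ∀ k ∈ S, ∀ k' ∈ l, ∀ b, k ∉ l → f b k = f b k' → Chain f S (i + 1) l := by
      intro k hk k' hk' b hkl h
      refine Or.inl ⟨k, hk, k', hk', b, ⟨hkl, h⟩, ih _ ?_⟩
      have := Finset.card_insert_le k l
      omega
    have ⟨h1, h2, h3, h4, h5⟩ := hch
    dsimp only at hy hz hk h1 h2 h4 h5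
    by_cases hxl : x ∈ l
    · rcases hk with rfl | rfl | rfl
      · exact absurd hxl hkl
      · exact hext _ hy _ hxl b hkl h4
      · exact hext _ hz _ hxl c hkl h5
    by_cases hyl : y ∈ l
    · exact hext _ hx _ hyl b hxl h4.symm
    by_cases hzl : z ∈ l
    · exact hext _ hx _ hzl c hxl h5.symm
    refine Or.inr ⟨x, hx, y, hy, z, hz, b, c, ⟨⟨hxl, hyl, hzl⟩, hch⟩, ih _ ?_⟩
    have := Finset.card_insert_le x (insert y (insert z l))
    have := Finset.card_insert_le y (insert z l)
    have := Finset.card_insert_le z l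
    omega

end Chain

/-! ### The probability of a chain -/

section Probability

variable {Ω K : Type*} {M : ℕ}

/-- The event `E` is determined by the hash values `F ω b k` with `(b, k)` in `T`. -/
def DeterminedBy (F : Ω → Hash K M) (T : Finset (Bool × K)) (E : Set Ω) : Prop :=
  ∃ A : Set (T → Fin M), E = {ω | (fun i : T => F ω i.1.1 i.1.2) ∈ A}

theorem DeterminedBy.mono {F : Ω → Hash K M} {T T' : Finset (Bool × K)} {E : Set Ω} (hT : T ⊆ T') :
    DeterminedBy F T E → DeterminedBy F T' E := by
  rintro ⟨A, rfl⟩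
  exact ⟨{g | (fun i : T => g ⟨i.1, hT i.2⟩) ∈ A}, rfl⟩

theorem DeterminedBy.inter {F : Ω → Hash K M} {T : Finset (Bool × K)} {E E' : Set Ω} :
    DeterminedBy F T E → DeterminedBy F T E' → DeterminedBy F T (E ∩ E') := by
  rintro ⟨A, rfl⟩ ⟨A', rfl⟩
  exact ⟨A ∩ A', rfl⟩

theorem determinedBy_collision {F : Ω → Hash K M} {T : Finset (Bool × K)} {u v : Bool × K}
    (hu : u ∈ T) (hv : v ∈ T) : DeterminedBy F T {ω | F ω u.1 u.2 = F ω v.1 v.2} :=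
  ⟨{g | g ⟨u, hu⟩ = g ⟨v, hv⟩}, rfl⟩

variable [MeasurableSpace Ω]

theorem DeterminedBy.measurableSet {P : Measure Ω} {F : Ω → Hash K M} (hF : IsFullyRandom P F)
    {T : Finset (Bool × K)} {E : Set Ω} (hE : DeterminedBy F T E) : MeasurableSet E := by
  obtain ⟨A, rfl⟩ := hE
  have hm : Measurable fun ω (i : T) => F ω i.1.1 i.1.2 :=
    measurable_pi_iff.2 fun i => hF.measurable _ _
  exact hm (Set.toFinite A).measurableSet

/-- A hash value that has not been looked at yet collides with a given one with probability `1 / M`. -/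
theorem IsFullyRandom.collision_le [DecidableEq K] {P : Measure Ω} [IsProbabilityMeasure P]
    {F : Ω → Hash K M} (hF : IsFullyRandom P F) {T : Finset (Bool × K)} {E : Set Ω}
    (hE : DeterminedBy F T E) {u v : Bool × K} (hu : u ∉ T) (hv : v ∈ T) :
    P.real (E ∩ {ω | F ω u.1 u.2 = F ω v.1 v.2}) ≤ P.real E / M := by
  have hcell : ∀ c : Fin M, DeterminedBy F T {ω | F ω v.1 v.2 = c} :=
    fun c => ⟨{g | g ⟨v, hv⟩ = c}, rfl⟩
  have hind := hF.indep.indepFun_finset T {u} (by simpa using hu)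
    (fun i => hF.measurable i.1 i.2)
  have hprod : ∀ c : Fin M, P.real ((E ∩ {ω | F ω v.1 v.2 = c}) ∩ {ω | F ω u.1 u.2 = c}) =
      P.real (E ∩ {ω | F ω v.1 v.2 = c}) / M := by
    intro c
    obtain ⟨A, hA⟩ := hE.inter (hcell c)
    have := hind.measure_inter_preimage_eq_mul A {g | g ⟨u, by simp⟩ = c}
      (Set.toFinite _).measurableSet (Set.toFinite _).measurableSet
    rw [hA]
    have h2 := hF.uniform u.1 u.2 c
    rw [div_eq_mul_one_div, ← h2]
    simp only [Measure.real]
    rw [← ENNReal.toReal_mul]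
    exact congrArg ENNReal.toReal this
  have hsub : E ∩ {ω | F ω u.1 u.2 = F ω v.1 v.2} ⊆ ⋃ c ∈ (Finset.univ : Finset (Fin M)),
      ((E ∩ {ω | F ω v.1 v.2 = c}) ∩ {ω | F ω u.1 u.2 = c}) := by
    rintro ω ⟨h₁, h₂⟩
    simp only [Set.mem_iUnion]
    exact ⟨F ω v.1 v.2, Finset.mem_univ _, ⟨h₁, rfl⟩, h₂⟩
  have hE' : E = ⋃ c ∈ (Finset.univ : Finset (Fin M)), (E ∩ {ω | F ω v.1 v.2 = c}) := by
    ext ω; simp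
  calc P.real (E ∩ {ω | F ω u.1 u.2 = F ω v.1 v.2})
      ≤ P.real (⋃ c ∈ (Finset.univ : Finset (Fin M)),
        ((E ∩ {ω | F ω v.1 v.2 = c}) ∩ {ω | F ω u.1 u.2 = c})) :=
        measureReal_mono hsub (measure_ne_top _ _)
    _ ≤ ∑ c : Fin M, P.real ((E ∩ {ω | F ω v.1 v.2 = c}) ∩ {ω | F ω u.1 u.2 = c}) :=
        measureReal_biUnion_finset_le _ _
    _ = (∑ c : Fin M, P.real (E ∩ {ω | F ω v.1 v.2 = c})) / M := by
        rw [Finset.sum_div]; exact Finset.sum_congr rfl fun c _ => hprod c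
    _ = P.real E / M := by
        conv_rhs => rw [hE']
        rw [measureReal_biUnion_finset]
        · intro c _ c' _ hcc
          refine Set.disjoint_left.2 fun ω h₁ h₂ => hcc ?_
          exact h₁.2.symm.trans h₂.2
        · exact fun c _ => (hE.inter (hcell c)).measurableSet hF

theorem measureReal_biUnion_le_card_mul {P : Measure Ω} {ι : Type*} (s : Finset ι) (A : ι → Set Ω)
    {r : ℝ} (h : ∀ j ∈ s, P.real (A j) ≤ r) : P.real (⋃ j ∈ s, A j) ≤ s.card * r :=
  (measureReal_biUnion_finset_le s A).trans ((Finset.sum_le_sum h).trans (by simp))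

variable [DecidableEq K]

/-- Every step of a chain that explores at most `d` keys costs a factor: there are at most `2 n d` ways
to add a key that collides once, and at most `4 n ^ 3` ways to add a cherry, in which two new hash
values collide. -/
theorem IsFullyRandom.chain_le {P : Measure Ω} [IsProbabilityMeasure P] {F : Ω → Hash K M}
    (hF : IsFullyRandom P F) {S : Finset K} {n d : ℝ} (hn : (S.card : ℝ) ≤ n) (i : ℕ) :
    ∀ (l : Finset K) (E : Set Ω), (l.card : ℝ) + 3 * i ≤ d →
      DeterminedBy F (Finset.univ ×ˢ l) E →
      P.real (E ∩ {ω | Chain (F ω) S i l}) ≤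
        (2 * n * d / M + 4 * n ^ 3 / M ^ 2) ^ i * P.real E := by
  set w : ℝ := 2 * n * d / M + 4 * n ^ 3 / M ^ 2 with hw
  have hn0 : 0 ≤ n := (Nat.cast_nonneg _).trans hn
  induction i with
  | zero => intro l E _ _; simpa using measureReal_mono Set.inter_subset_left
  | succ i ih =>
    intro l E hl hE
    push_cast at hl
    have hd : 0 ≤ d := le_trans (by positivity) hl
    have hw0 : 0 ≤ w := by positivity
    have hPE : 0 ≤ P.real E := measureReal_nonneg
    set B := w ^ i * (P.real E / M) with hB
    have hB0 : 0 ≤ B := by positivity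
    have h₁ : ∀ x ∈ S, ∀ y ∈ l, ∀ b : Bool,
        P.real (E ∩ {ω | (x ∉ l ∧ F ω b x = F ω b y) ∧ Chain (F ω) S i (insert x l)}) ≤ B := by
      intro x _ y hy b
      by_cases hx : x ∈ l
      · simpa [hx] using hB0
      have hE' : DeterminedBy F (Finset.univ ×ˢ insert x l) (E ∩ {ω | F ω b x = F ω b y}) :=
        (hE.mono (Finset.product_subset_product_right (Finset.subset_insert _ _))).inter
          (determinedBy_collision (u := (b, x)) (v := (b, y)) (by simp) (by simp [hy]))
      have hcard : ((insert x l).card : ℝ) + 3 * i ≤ d := by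
        have : ((insert x l).card : ℝ) ≤ l.card + 1 := by exact_mod_cast Finset.card_insert_le x l
        linarith
      have hcol := hF.collision_le hE (u := (b, x)) (v := (b, y)) (by simp [hx]) (by simp [hy])
      have hset : E ∩ {ω | (x ∉ l ∧ F ω b x = F ω b y) ∧ Chain (F ω) S i (insert x l)} =
          (E ∩ {ω | F ω b x = F ω b y}) ∩ {ω | Chain (F ω) S i (insert x l)} := by
        ext ω; simp [hx, and_assoc]
      rw [hset]
      exact (ih _ _ hcard hE').trans (mul_le_mul_of_nonneg_left hcol (by positivity))
    have h₂ : ∀ x ∈ S, ∀ y ∈ S, ∀ z ∈ S, ∀ b c : Bool,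
        P.real (E ∩ {ω | ((x ∉ l ∧ y ∉ l ∧ z ∉ l) ∧ IsCherry (F ω) x (b, y) (c, z)) ∧
          Chain (F ω) S i (insert x (insert y (insert z l)))}) ≤ B / M := by
      intro x _ y _ z _ b c
      by_cases hne : (x ∉ l ∧ y ∉ l ∧ z ∉ l) ∧ y ≠ x ∧ z ≠ x ∧ (b, y) ≠ (c, z)
      swap
      · have : {ω | ((x ∉ l ∧ y ∉ l ∧ z ∉ l) ∧ IsCherry (F ω) x (b, y) (c, z)) ∧
            Chain (F ω) S i (insert x (insert y (insert z l)))} = ∅ := by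
          ext ω
          simp only [IsCherry, Set.mem_ofPred_eq, Set.mem_empty_iff_false, iff_false]
          tauto
        rw [this]
        simp only [Set.inter_empty, measureReal_empty]
        positivity
      obtain ⟨⟨hx, hy, hz⟩, hyx, hzx, hbc⟩ := hne
      set T : Finset (Bool × K) := Finset.univ ×ˢ insert x l with hT
      have hET : DeterminedBy F T E :=
        hE.mono (Finset.product_subset_product_right (Finset.subset_insert _ _))
      have hcol := hF.collision_le hET (u := (b, y)) (v := (b, x)) (by simp [hT, hy, hyx])
        (by simp [hT])
      have hET' : DeterminedBy F (insert (b, y) T) (E ∩ {ω | F ω b y = F ω b x}) :=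
        (hET.mono (Finset.subset_insert _ _)).inter
          (determinedBy_collision (u := (b, y)) (v := (b, x)) (by simp) (by simp [hT]))
      have hcol' := hF.collision_le hET' (u := (c, z)) (v := (c, x))
        (by simp only [hT, Finset.mem_insert, hbc.symm, false_or]; simp [hz, hzx]) (by simp [hT])
      dsimp only at hcol hcol'
      have hE' : DeterminedBy F (Finset.univ ×ˢ insert x (insert y (insert z l)))
          ((E ∩ {ω | F ω b y = F ω b x}) ∩ {ω | F ω c z = F ω c x}) := by
        refine ((hE.mono (Finset.product_subset_product_right ?_)).inter
          (determinedBy_collision (u := (b, y)) (v := (b, x)) (by simp) (by simp))).inter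
          (determinedBy_collision (u := (c, z)) (v := (c, x)) (by simp) (by simp))
        intro k hk
        simp [hk]
      have hcard : ((insert x (insert y (insert z l))).card : ℝ) + 3 * i ≤ d := by
        have h1 := Finset.card_insert_le x (insert y (insert z l))
        have h2 := Finset.card_insert_le y (insert z l)
        have h3 := Finset.card_insert_le z l
        have : ((insert x (insert y (insert z l))).card : ℝ) ≤ l.card + 3 := by
          exact_mod_cast (by omega : (insert x (insert y (insert z l))).card ≤ l.card + 3)
        linarith
      have hset : E ∩ {ω | ((x ∉ l ∧ y ∉ l ∧ z ∉ l) ∧ IsCherry (F ω) x (b, y) (c, z)) ∧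
            Chain (F ω) S i (insert x (insert y (insert z l)))} ⊆
          ((E ∩ {ω | F ω b y = F ω b x}) ∩ {ω | F ω c z = F ω c x}) ∩
            {ω | Chain (F ω) S i (insert x (insert y (insert z l)))} := by
        rintro ω ⟨hω, ⟨-, hch⟩, hc⟩
        exact ⟨⟨⟨hω, hch.2.2.2.1⟩, hch.2.2.2.2⟩, hc⟩
      calc _ ≤ _ := measureReal_mono hset
        _ ≤ _ := ih _ _ hcard hE'
        _ ≤ w ^ i * (P.real E / M / M) := by
            gcongr
            exact hcol'.trans (by gcongr)
        _ = B / M := by rw [hB]; ring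
    have hsub : E ∩ {ω | Chain (F ω) S (i + 1) l} ⊆
        (⋃ x ∈ S, ⋃ y ∈ l, ⋃ b ∈ (Finset.univ : Finset Bool),
          (E ∩ {ω | (x ∉ l ∧ F ω b x = F ω b y) ∧ Chain (F ω) S i (insert x l)})) ∪
        ⋃ x ∈ S, ⋃ y ∈ S, ⋃ z ∈ S, ⋃ b ∈ (Finset.univ : Finset Bool),
          ⋃ c ∈ (Finset.univ : Finset Bool),
          (E ∩ {ω | ((x ∉ l ∧ y ∉ l ∧ z ∉ l) ∧ IsCherry (F ω) x (b, y) (c, z)) ∧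
            Chain (F ω) S i (insert x (insert y (insert z l)))}) := by
      rintro ω ⟨hω, ⟨x, hx, y, hy, b, h⟩ | ⟨x, hx, y, hy, z, hz, b, c, h⟩⟩
      · left
        simp only [Set.mem_iUnion]
        exact ⟨x, hx, y, hy, b, Finset.mem_univ _, hω, h⟩
      · right
        simp only [Set.mem_iUnion]
        exact ⟨x, hx, y, hy, z, hz, b, Finset.mem_univ _, c, Finset.mem_univ _, hω, h⟩
    have hl' : (l.card : ℝ) ≤ d := by linarith [(Nat.cast_nonneg i : (0 : ℝ) ≤ i)]
    have hu₁ := measureReal_biUnion_le_card_mul S _ fun x hx =>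
      measureReal_biUnion_le_card_mul l _ fun y hy =>
        measureReal_biUnion_le_card_mul Finset.univ _ fun b _ => h₁ x hx y hy b
    have hu₂ := measureReal_biUnion_le_card_mul S _ fun x hx =>
      measureReal_biUnion_le_card_mul S _ fun y hy =>
        measureReal_biUnion_le_card_mul S _ fun z hz =>
          measureReal_biUnion_le_card_mul Finset.univ _ fun b _ =>
            measureReal_biUnion_le_card_mul Finset.univ _ fun c _ => h₂ x hx y hy z hz b c
    refine (measureReal_mono hsub).trans ((measureReal_union_le _ _).trans
      ((add_le_add hu₁ hu₂).trans ?_))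
    simp only [Finset.card_univ, Fintype.card_bool, Nat.cast_ofNat]
    calc (S.card : ℝ) * (l.card * (2 * B)) + S.card * (S.card * (S.card * (2 * (2 * (B / M)))))
        ≤ n * (d * (2 * B)) + n * (n * (n * (2 * (2 * (B / M))))) := by gcongr
      _ = w ^ (i + 1) * P.real E := by rw [pow_succ, hB, hw]; ring

end Probability

/-! ### Union bound over the operations -/

section Final

variable {K V Ω : Type*} [DecidableEq K]

/-- The first time at which the deques have more than `s` entries, more than `s` keys are crowded in the
window before that time, whence there is a chain. -/
theorem exists_chain_of_not_smallL {M : ℕ} {f : Hash K M} {q : ℕ} (hq : 0 < q)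
    {ops : List (Op K V)} (hnew : InsertsNew ops) {s : ℝ} (hs : 0 ≤ s) (h : ¬ SmallL f q s ops) :
    ∃ t ∈ Finset.Icc 1 ops.length,
      Chain f (window ops t (2 * ((⌊s⌋₊ + 3) * q))) (⌊s⌋₊ / 3 + 1) ∅ := by
  classical
  have hex : ∃ t, t ≤ ops.length ∧ s < (run f q (ops.take t)).sizeL := by
    unfold SmallL at h
    push Not at h
    obtain ⟨pre, hpre, hlt⟩ := h
    exact ⟨pre.length, hpre.length_le, by rwa [← List.prefix_iff_eq_take.1 hpre]⟩
  obtain ⟨ht, hlt⟩ := Nat.find_spec hex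
  have hmin : ∀ t' < Nat.find hex, (run f q (ops.take t')).sizeL + 2 ≤ ⌊s⌋₊ + 2 := by
    intro t' ht'
    have := Nat.find_min hex ht'
    push Not at this
    exact Nat.add_le_add_right (Nat.le_floor (this (by omega))) 2
  generalize Nat.find hex = t at ht hlt hmin
  obtain ⟨h₁, h₂⟩ := Inv.run hq hnew t ht hmin
  have hsize := h₁.sizeL_le h₂
  have hfl : ⌊s⌋₊ < (run f q (ops.take t)).sizeL := (Nat.floor_lt hs).2 hlt
  refine ⟨t, Finset.mem_Icc.2 ⟨?_, ht⟩, chain_of_card_crowded _ _ ?_⟩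
  · rcases Nat.eq_zero_or_pos t with rfl | h
    · simp [run, State.empty, State.sizeL] at hfl
    · exact h
  · rw [Finset.card_empty]
    rw [show ⌊s⌋₊ + 3 = ⌊s⌋₊ + 2 + 1 from rfl]
    have := hfl.trans_le hsize
    omega

theorem not_chain_of_card_le_one {M : ℕ} {f : Hash K M} {S : Finset K} (hS : S.card ≤ 1) (i : ℕ) :
    ¬ Chain f S (i + 1) ∅ := by
  rintro (⟨x, -, y, hy, -⟩ | ⟨x, hx, y, hy, z, -, b, c, ⟨-, hch⟩, -⟩)
  · simp at hy
  · exact hch.1 (Finset.card_le_one.1 hS y hy x hx)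

variable [MeasurableSpace Ω] {P : Measure Ω} [IsProbabilityMeasure P]

/-- With `u = m ^ (1/6)`, the window has at most `u ^ 2 + 2 * (4 * u) * (2 * u)` keys, the tables have at least
`u ^ 4` cells, and at most `4 * u` keys are explored. -/
theorem IsFullyRandom.chain_window_le {m : ℕ} (hm : 1 ≤ m) {F : Ω → Hash K (tableSize m)}
    (hF : IsFullyRandom P F) {ops : List (Op K V)} (hbdd : IsBounded ((m : ℝ) ^ (1 / 3 : ℝ)) ops)
    {s : ℝ} (hs₀ : 0 ≤ s) (hs : s ≤ (m : ℝ) ^ (1 / 6 : ℝ)) (t : ℕ) :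
    P.real {ω | Chain (F ω) (window ops t (2 * ((⌊s⌋₊ + 3) * period m))) (⌊s⌋₊ / 3 + 1) ∅} ≤
      (20000 / (m : ℝ) ^ (1 / 6 : ℝ)) ^ (⌊s⌋₊ / 3 + 1) := by
  have hm0 : (0 : ℝ) ≤ m := Nat.cast_nonneg m
  have hu1 : 1 ≤ (m : ℝ) ^ (1 / 6 : ℝ) := Real.one_le_rpow (by exact_mod_cast hm) (by norm_num)
  have hpow : ∀ j : ℕ, (m : ℝ) ^ ((j : ℝ) / 6) = ((m : ℝ) ^ (1 / 6 : ℝ)) ^ j := by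
    intro j
    rw [← Real.rpow_natCast, ← Real.rpow_mul hm0]
    ring_nf
  have h2 := hpow 2
  have h4 := hpow 4
  norm_num at h2 h4
  have hM : ((m : ℝ) ^ (1 / 6 : ℝ)) ^ 4 ≤ (tableSize m : ℝ) := by
    rw [← h4]; exact Nat.le_ceil _
  have hq : (period m : ℝ) ≤ (m : ℝ) ^ (1 / 6 : ℝ) + 1 := (Nat.ceil_lt_add_one (by positivity)).le
  rw [h2] at hbdd
  generalize (m : ℝ) ^ (1 / 6 : ℝ) = u at *
  have hfl : (⌊s⌋₊ : ℝ) ≤ u := (Nat.floor_le hs₀).trans hs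
  have hcard : ((window ops t (2 * ((⌊s⌋₊ + 3) * period m))).card : ℝ) ≤ 17 * u ^ 2 := by
    refine (card_window_le hbdd _ t).trans ?_
    push_cast
    have : ((⌊s⌋₊ : ℝ) + 3) * period m ≤ (4 * u) * (2 * u) := by
      gcongr <;> linarith
    linarith
  have hd : ((∅ : Finset K).card : ℝ) + 3 * ((⌊s⌋₊ / 3 + 1 : ℕ) : ℝ) ≤ 4 * u := by
    have : ((3 * (⌊s⌋₊ / 3 + 1) : ℕ) : ℝ) ≤ ((⌊s⌋₊ + 3 : ℕ) : ℝ) := by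
      exact_mod_cast (by omega : 3 * (⌊s⌋₊ / 3 + 1) ≤ ⌊s⌋₊ + 3)
    push_cast at this ⊢
    simp only [Finset.card_empty, Nat.cast_zero]
    linarith
  have hdet : DeterminedBy F (Finset.univ ×ˢ (∅ : Finset K)) Set.univ :=
    ⟨Set.univ, Set.ext fun _ => ⟨fun _ => Set.mem_univ _, fun _ => Set.mem_univ _⟩⟩
  have h := hF.chain_le hcard _ ∅ Set.univ hd hdet
  rw [Set.univ_inter, probReal_univ, mul_one] at h
  refine h.trans ?_
  gcongr
  have hu0 : 0 < u := by linarith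
  calc 2 * (17 * u ^ 2) * (4 * u) / (tableSize m : ℝ) + 4 * (17 * u ^ 2) ^ 3 / (tableSize m : ℝ) ^ 2
      ≤ 2 * (17 * u ^ 2) * (4 * u) / u ^ 4 + 4 * (17 * u ^ 2) ^ 3 / (u ^ 4) ^ 2 := by gcongr
    _ = (136 + 19652 / u) / u := by field_simp; ring
    _ ≤ 20000 / u := by
        gcongr
        have : 19652 / u ≤ 19652 := div_le_self (by norm_num) hu1
        linarith

/-- The bound on the probability of a chain, for large `m`. -/
theorem pow_le_inv_rpow {m : ℝ} (hm : 1 ≤ m) (hlarge : 20000 ^ 2 ≤ m ^ (1 / 6 : ℝ)) {s c : ℝ}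
    (hc : c ≤ 1 / 24) :
    (20000 / m ^ (1 / 6 : ℝ)) ^ (⌊s⌋₊ / 3 + 1) ≤ 1 / m ^ (c * √s) := by
  set i := ⌊s⌋₊ / 3 + 1 with hi
  have hi1 : (1 : ℝ) ≤ i := by exact_mod_cast Nat.le_add_left 1 _
  have hsi : s ≤ 3 * i := by
    have h1 := (Nat.lt_floor_add_one s).le
    have h2 : ((⌊s⌋₊ + 1 : ℕ) : ℝ) ≤ ((3 * i : ℕ) : ℝ) := by
      exact_mod_cast (by omega : ⌊s⌋₊ + 1 ≤ 3 * i)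
    push_cast at h2
    linarith
  have hsqrt : √s ≤ 2 * i := Real.sqrt_le_iff.2 ⟨by positivity, by nlinarith⟩
  have hm0 : 0 < m := by linarith
  have hhalf : m ^ (1 / 6 : ℝ) = m ^ (1 / 12 : ℝ) * m ^ (1 / 12 : ℝ) := by
    rw [← Real.rpow_add hm0]; norm_num
  have h20 : 20000 ≤ m ^ (1 / 12 : ℝ) := by
    have : (0 : ℝ) ≤ m ^ (1 / 12 : ℝ) := by positivity
    rw [hhalf, ← sq] at hlarge
    exact le_of_sq_le_sq hlarge this
  have hbase : 20000 / m ^ (1 / 6 : ℝ) ≤ 1 / m ^ (1 / 12 : ℝ) := by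
    rw [hhalf, div_le_div_iff₀ (by positivity) (by positivity)]
    nlinarith [show (0 : ℝ) < m ^ (1 / 12 : ℝ) by positivity]
  calc (20000 / m ^ (1 / 6 : ℝ)) ^ i ≤ (1 / m ^ (1 / 12 : ℝ)) ^ i := by gcongr
    _ = 1 / m ^ ((1 / 12 : ℝ) * i) := by
        rw [div_pow, one_pow, Real.rpow_mul hm0.le, Real.rpow_natCast]
    _ ≤ 1 / m ^ (c * √s) := by
        refine one_div_le_one_div_of_le (by positivity)
          (Real.rpow_le_rpow_of_exponent_le hm ?_)
        nlinarith [mul_le_mul_of_nonneg_right hc (Real.sqrt_nonneg s)]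

/-- For small `m` the constant `c` is chosen so small that a union bound over two operations is
trivial. -/
theorem rpow_le_two {m : ℝ} (hm : 1 ≤ m) {C : ℝ} (hC : 1 ≤ C) (hsmall : m ^ (1 / 6 : ℝ) ≤ C)
    {s : ℝ} (hs : s ≤ m ^ (1 / 6 : ℝ)) :
    m ^ (1 / (24 * C ^ 2) * √s) ≤ 2 := by
  have hm0 : 0 < m := by linarith
  have hlog : Real.log m ≤ 6 * C := by
    have h1 : Real.log (m ^ (1 / 6 : ℝ)) ≤ C :=
      (Real.log_le_sub_one_of_pos (by positivity)).trans (by linarith)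
    rw [Real.log_rpow hm0] at h1
    linarith
  have hlog0 : 0 ≤ Real.log m := Real.log_nonneg hm
  have hsqrt : √s ≤ C := Real.sqrt_le_iff.2 ⟨by linarith, by nlinarith⟩
  rw [Real.rpow_def_of_pos hm0, ← Real.le_log_iff_exp_le two_pos]
  calc Real.log m * (1 / (24 * C ^ 2) * √s) ≤ (6 * C) * (1 / (24 * C ^ 2) * C) := by gcongr
    _ = 1 / 4 := by field_simp; norm_num
    _ ≤ Real.log 2 := by linarith [Real.log_two_gt_d9]

end Final

end InnerCuckoo

theorem theorem1 :
    ∃ c : ℝ, 0 < c ∧ ∃ A : ℕ,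
      ∀ {K V Ω : Type*} [DecidableEq K] [MeasurableSpace Ω] (P : Measure Ω) [IsProbabilityMeasure P]
        (m : ℕ) (_hm : 1 ≤ m)
        (F : Ω → InnerCuckoo.Hash K (InnerCuckoo.tableSize m))
        (_hF : InnerCuckoo.IsFullyRandom P F)
        (p : Polynomial ℝ) (n : ℕ) (ops : List (InnerCuckoo.Op K V))
        (_hlen : (ops.length : ℝ) = p.eval (n : ℝ))
        (_hbdd : InnerCuckoo.IsBounded ((m : ℝ) ^ (1 / 3 : ℝ)) ops)
        (_hnew : InnerCuckoo.InsertsNew ops)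
        (s : ℝ) (_hs₀ : 0 ≤ s) (_hs : s ≤ (m : ℝ) ^ (1 / 6 : ℝ)),
        1 - p.eval (n : ℝ) / (m : ℝ) ^ (c * √s) ≤
          P.real {ω | InnerCuckoo.InsertsWithin (F ω) (InnerCuckoo.period m) A ops ∧
            InnerCuckoo.SmallL (F ω) (InnerCuckoo.period m) s ops} := by
  -- For `m ^ (1/6) ≥ 20000 ^ 2` a step of a chain costs a factor `m ^ (1/12)`; the constant is small enough
  -- to make the claim trivial for smaller `m` if there are two operations.
  refine ⟨1 / (24 * (20000 ^ 2) ^ 2), by positivity, 1342, ?_⟩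
  intro K V Ω _ _ P _ m hm F hF p n ops hlen hbdd hnew s hs₀ hs
  rw [← hlen]
  have hm1 : (1 : ℝ) ≤ m := by exact_mod_cast hm
  have hu1 : 1 ≤ (m : ℝ) ^ (1 / 6 : ℝ) := Real.one_le_rpow hm1 (by norm_num)
  have hq : 0 < InnerCuckoo.period m := Nat.ceil_pos.2 (by linarith)
  set good : Set Ω := {ω | InnerCuckoo.InsertsWithin (F ω) (InnerCuckoo.period m) 1342 ops ∧
    InnerCuckoo.SmallL (F ω) (InnerCuckoo.period m) s ops} with hgood
  set bad : ℕ → Set Ω := fun t => {ω | InnerCuckoo.Chain (F ω)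
    (InnerCuckoo.window ops t (2 * ((⌊s⌋₊ + 3) * InnerCuckoo.period m))) (⌊s⌋₊ / 3 + 1) ∅} with hbad
  have hcover : (Set.univ : Set Ω) ⊆ good ∪ ⋃ t ∈ Finset.Icc 1 ops.length, bad t := by
    intro ω _
    by_cases h : InnerCuckoo.SmallL (F ω) (InnerCuckoo.period m) s ops
    · exact Or.inl ⟨fun pre k v _ => InnerCuckoo.exec_insert_steps_le _ _ _ _ _, h⟩
    · obtain ⟨t, ht, hch⟩ := InnerCuckoo.exists_chain_of_not_smallL hq hnew hs₀ h
      refine Or.inr ?_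
      simp only [Set.mem_iUnion]
      exact ⟨t, ht, hch⟩
  have hone : ∀ r : ℝ, (∀ t ∈ Finset.Icc 1 ops.length, P.real (bad t) ≤ r) →
      1 ≤ P.real good + ops.length * r := by
    intro r hr
    calc (1 : ℝ) = P.real Set.univ := probReal_univ.symm
      _ ≤ _ := measureReal_mono hcover
      _ ≤ _ := measureReal_union_le _ _
      _ ≤ P.real good + (Finset.Icc 1 ops.length).card * r := by
          gcongr
          exact InnerCuckoo.measureReal_biUnion_le_card_mul _ _ hr
      _ = _ := by simp
  rcases le_total (20000 ^ 2) ((m : ℝ) ^ (1 / 6 : ℝ)) with hlarge | hsmall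
  · have := hone _ fun t _ => (hF.chain_window_le hm hbdd hs₀ hs t).trans
      (InnerCuckoo.pow_le_inv_rpow hm1 hlarge (c := 1 / (24 * (20000 ^ 2) ^ 2)) (by norm_num))
    rw [mul_one_div] at this
    linarith
  · rcases Nat.lt_or_ge ops.length 2 with h2 | h2
    · have := hone 0 fun t ht => by
        have hcard := InnerCuckoo.card_window_le_length (ops := ops) t
          (2 * ((⌊s⌋₊ + 3) * InnerCuckoo.period m))
        have : bad t = ∅ := Set.eq_empty_of_forall_notMem fun ω =>
          InnerCuckoo.not_chain_of_card_le_one (by have := Finset.mem_Icc.1 ht; omega) _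
        simp [this]
      have h0 : 0 ≤ (ops.length : ℝ) / (m : ℝ) ^ (1 / (24 * (20000 ^ 2) ^ 2) * √s) := by positivity
      linarith
    · have h1 := InnerCuckoo.rpow_le_two hm1 (by norm_num) hsmall hs
      have h2' : (2 : ℝ) ≤ ops.length := by exact_mod_cast h2
      have : 1 ≤ (ops.length : ℝ) / (m : ℝ) ^ (1 / (24 * (20000 ^ 2) ^ 2) * √s) := by
        rw [one_le_div (by positivity)]
        exact h1.trans h2'
      linarith [measureReal_nonneg (μ := P) (s := good)]
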